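/- Let $M, j_0 \ge 0$ be integers and let $\mathcal N$ be a finite set. Consider an ergodic continuous-time Markov chain on $\mathcal N \cup \{(m,j) : 0\le m\le M,\ j\ge j_0\}$, with $q(x,y)\ge 0$ the rate of transitions from $x$ to $y\neq x$ (and $q(x,x)=0$), whose only possible transitions are: arbitrary transitions inside $\mathcal N$; arbitrary transitions between $\mathcal N$ and the states $(m,j_0)$, in both directions; $(m,j)\to(m,j+1)$ at rate $\lambda_m$; $(m,j+1)\to(m,j)$ at rate $\mu_m$; and, for $m<i\le M$ and $\Delta\in\{-1,0,1\}$ with $j,\ j+\Delta\ge j_0$, $(m,j)\to(i,j+\Delta)$ at rate $\alpha_m\langle i-m\rangle\langle\Delta\rangle$ (a class $\mathbb M$ chain). Put $\alpha_m=\sum_{i=m+1}^M\sum_{\Delta=-1}^1\alpha_m\langle i-m\rangle\langle\Delta\rangle$ and assume $\lambda_m,\mu_m>0$ for all $m$. Let $$\phi_m=\frac{\alpha_m+\lambda_m+\mu_m-\sqrt{(\alpha_m+\lambda_m+\mu_m)^2-4\lambda_m\mu_m}}{2\lambda_m},\qquad r_m=\frac{\lambda_m}{\mu_m}\phi_m,\qquad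 \Omega_m=\frac{r_m}{\lambda_m(1-r_m\phi_m)},$$ and assume $r_0=r_1=\cdots=r_M$. Let $\pi$ be the stationary distribution. Then there are real numbers $c_{m,k}$ $(0\le k\le m\le M)$ such that for all $0\le m\le M$ and $j\ge j_0$ $$\pi_{(m,j)}=\sum_{k=0}^m c_{m,k}\binom{j-(j_0+1)+k}{k}r_0^{\,j-j_0}$$ (where $\binom{-1}{0}=1$), and they satisfy $$c_{m,0}=\pi_{(m,j_0)}\qquad(0\le m\le M),$$ $$c_{m,k}=\Omega_m r_0\sum_{u=k}^{m-1}\sum_{i=u}^{m-1}c_{i,u}\sum_{\Delta=-1}^1\frac{\alpha_i\langle m-i\rangle\langle\Delta\rangle\,\phi_m^{\Delta+1}}{(1-r_0\phi_m)^{u+1-k}}-\frac1{\lambda_m}\sum_{i=k}^{m-1}c_{i,k}\,\alpha_i\langle m-i\rangle\langle1\rangle+\Omega_m\sum_{i=k-1}^{m-1}c_{i,k-1}\sum_{\Delta=-1}^1\alpha_i\langle m-i\rangle\langle\Delta\rangle\, r_0^{-\Delta}\qquad(1\le k\le m-1,\ m\le M),$$ $$c_{m,m}=c_{m-1,m-1}\,\Omega_m\sum_{\Delta=-1}^1\alpha_{m-1}\langle1\rangle\langle\Delta\rangle\,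 r_0^{-\Delta}\qquad(1\le m\le M),$$ together with the balance equations of the states $(m,j_0)$, $0\le m\le M$, $$\pi_{(m,j_0)}\Big(\lambda_m+\sum_{i=m+1}^M\sum_{\Delta=0}^1\alpha_m\langle i-m\rangle\langle\Delta\rangle+\sum_{x\in\mathcal N}q((m,j_0),x)\Big)=\mu_m\sum_{k=0}^m c_{m,k}r_0+\sum_{x\in\mathcal N}q(x,(m,j_0))\pi_x+\sum_{i=0}^{m-1}\Big(\alpha_i\langle m-i\rangle\langle-1\rangle\sum_{k=0}^i c_{i,k}r_0+\alpha_i\langle m-i\rangle\langle0\rangle\,\pi_{(i,j_0)}\Big),$$ those of the states $x\in\mathcal N$, $$\pi_x\Big(\sum_{m=0}^M q(x,(m,j_0))+\sum_{y\in\mathcal N}q(x,y)\Big)=\sum_{m=0}^M q((m,j_0),x)\pi_{(m,j_0)}+\sum_{y\in\mathcal N}q(y,x)\pi_y,$$ and the normalization $$\sum_{x\in\mathcal N}\pi_x+\sum_{m=0}^M\Big(\frac{c_{m,0}}{1-r_0}+\sum_{k=1}^m\frac{c_{m,k}\,r_0}{(1-r_0)^{k+1}}\Big)=1.$$ -/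

import Mathlib

/-- The state space `𝓝 ∪ 𝓡`: a non-repeating portion `N`, and the repeating portion consisting of
the pairs `(m, j)` of a phase `0 ≤ m ≤ M` and a level `j ≥ j₀`. -/
abbrev State (N : Type*) (M j₀ : ℕ) : Type _ :=
  N ⊕ (Fin (M + 1) × {j : ℕ // j₀ ≤ j})

/-- The state `(m, j)` of the repeating portion. -/
abbrev State.rep {N : Type*} {M j₀ : ℕ} (m : Fin (M + 1)) (j : ℕ) (hj : j₀ ≤ j) :
    State N M j₀ :=
  Sum.inr (m, ⟨j, hj⟩)

/-- The transition rates of a class M continuous time Markov chain with non-repeating portion `N`,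
phases `0, …, M` and levels `j₀, j₀ + 1, …`. Phases are indexed by natural numbers; only the values
at phases `≤ M` are used. A transition rate from a state to itself is `0` by convention. -/
structure ClassM (N : Type*) (M j₀ : ℕ) where
  /-- rate of `(m, j) → (m, j + 1)` -/
  lam : ℕ → ℝ
  /-- rate of `(m, j + 1) → (m, j)` -/
  mu : ℕ → ℝ
  /-- `alp m d Δ` is the rate of `(m, j) → (m + d, j + Δ)`, for `d ≥ 1` and `Δ ∈ {-1, 0, 1}` -/
  alp : ℕ → ℕ → ℤ → ℝ
  /-- rates inside the non-repeating portion -/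
  qNN : N → N → ℝ
  /-- `qNR x m` is the rate of `x → (m, j₀)` -/
  qNR : N → Fin (M + 1) → ℝ
  /-- `qRN m x` is the rate of `(m, j₀) → x` -/
  qRN : Fin (M + 1) → N → ℝ
  lam_nonneg : ∀ m ≤ M, 0 ≤ lam m
  mu_nonneg : ∀ m ≤ M, 0 ≤ mu m
  alp_nonneg : ∀ m i, m < i → i ≤ M → ∀ Δ ∈ Finset.Icc (-1 : ℤ) 1, 0 ≤ alp m (i - m) Δ
  qNN_nonneg : ∀ x y, 0 ≤ qNN x y
  qNN_self : ∀ x, qNN x x = 0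
  qNR_nonneg : ∀ x m, 0 ≤ qNR x m
  qRN_nonneg : ∀ m x, 0 ≤ qRN m x

noncomputable section

namespace ClassM

variable {N : Type*} {M j₀ : ℕ}

/-- The transition rate `q(x, y)` from state `x` to state `y`. -/
def rate (C : ClassM N M j₀) : State N M j₀ → State N M j₀ → ℝ
  | Sum.inl x, Sum.inl y => C.qNN x y
  | Sum.inl x, Sum.inr (m, j) => if (j : ℕ) = j₀ then C.qNR x m else 0
  | Sum.inr (m, j), Sum.inl x => if (j : ℕ) = j₀ then C.qRN m x else 0
  | Sum.inr (m, j), Sum.inr (i, l) =>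
      if i = m then
        if (l : ℕ) = j + 1 then C.lam m
        else if (j : ℕ) = l + 1 then C.mu m
        else 0
      else if m < i ∧ |(l : ℤ) - (j : ℤ)| ≤ 1 then
        C.alp m (i - m) ((l : ℤ) - (j : ℤ))
      else 0

/-- Every state can be reached from every other one by transitions of positive rate. -/
def IsIrreducible (C : ClassM N M j₀) : Prop :=
  ∀ x y : State N M j₀, Relation.ReflTransGen (fun a b => 0 < C.rate a b) x y

/-- `π` is a stationary distribution: a probability distribution on the states that satisfies the
global balance equations. All sums over `y` have only finitely many nonzero terms when `N` is
finite. -/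
structure IsStationary (C : ClassM N M j₀) (π : State N M j₀ → ℝ) : Prop where
  nonneg : ∀ x, 0 ≤ π x
  hasSum_one : HasSum π 1
  balance : ∀ x, π x * ∑' y, C.rate x y = ∑' y, π y * C.rate y x

/-- Ergodicity: the chain is irreducible and positive recurrent. When `N` is finite, the transition
rates are bounded, so the chain does not explode, and positive recurrence of the irreducible chain
is the existence of a stationary distribution (which is then unique and is the limiting
distribution). -/
def IsErgodic (C : ClassM N M j₀) : Prop :=
  C.IsIrreducible ∧ ∃ π : State N M j₀ → ℝ, C.IsStationary π

/-- `α_m`, the total transition rate to other phases from a state `(m, j)` with `j ≥ j₀ + 1`. -/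
def alphaTot (C : ClassM N M j₀) (m : ℕ) : ℝ :=
  ∑ i ∈ Finset.Ioc m M, ∑ Δ ∈ Finset.Icc (-1 : ℤ) 1, C.alp m (i - m) Δ

/-- `ρ_m = λ_m / μ_m`. -/
def rho (C : ClassM N M j₀) (m : ℕ) : ℝ := C.lam m / C.mu m

/-- `φ_m(s)`, the Laplace transform of the M/M/1 busy period with rates `λ_m` and `μ_m`. -/
def phi (C : ClassM N M j₀) (m : ℕ) (s : ℝ) : ℝ :=
  (s + C.lam m + C.mu m - √((s + C.lam m + C.mu m) ^ 2 - 4 * C.lam m * C.mu m)) / (2 * C.lam m)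

/-- The base `r_m`. -/
def base (C : ClassM N M j₀) (m : ℕ) : ℝ :=
  if 0 < C.mu m then C.rho m * C.phi m (C.alphaTot m) else C.lam m / (C.lam m + C.alphaTot m)

/-- `Ω_m = r_m / (λ_m (1 - r_m φ_m(α_m)))`. -/
def Omega (C : ClassM N M j₀) (m : ℕ) : ℝ :=
  C.base m / (C.lam m * (1 - C.base m * C.phi m (C.alphaTot m)))

end ClassM

end

/-! Above level `j₀`, the balance equations of phase `m` form a second-order linear recurrence in
the level, driven by the lower phases. Its characteristic roots are `r_m` and `1 / φ_m ≥ 1`, so a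
solution tending to zero is determined by its value at `j₀` (`eq_zero_of_recurrence`). It therefore
suffices to exhibit one decaying solution with the right initial values and to induct on the phase
(`ClassM.eq_multichooseSum_of_balance`).

Since all bases equal `r_0`, each phase is driven at resonance, and the polynomial factor can gain
one degree per phase. In the basis `C(n + k - 1, k)`, moving up one level replaces the coefficients
`a k` by `a k - a (k + 1)` (`multichooseSum_eq_succ`). Comparing coefficients turns the balance
equations into a first-order recurrence in `k` (`ClassM.coeff_recurrence`), whose solution vanishing
for large `k` is the stated formula for `c_{m,k}`.

Decay of the candidate needs `r_0 < 1`. This comes from the last phase, which never changes phase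
within the repeating portion: were its base at least `1`, its probabilities would be nondecreasing
in the level yet summable, contradicting positivity. The remaining identities are the balance
equations at the boundary and the total mass, with the sums over states evaluated phase by phase. -/

section

open Filter Topology Finset

/-! ### Combinations of binomial coefficients: level shifts and generating series -/

/-- The value at level `n` of the combination `∑ a k * C(n + k - 1, k)`, `k < K`. -/
noncomputable def multichooseSum (K : ℕ) (a : ℕ → ℝ) (n : ℕ) : ℝ :=
  ∑ k ∈ range K, a k * ((n + k - 1).choose k : ℝ)

/-- Pascal's rule `C(n + k, k + 1) = C(n + k + 1, k + 1) - C(n + k, k)`, followed by reindexing. The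
vanishing of `a K` removes the boundary term. -/
theorem multichooseSum_eq_succ {K : ℕ} {a : ℕ → ℝ} (ha : ∀ k, K ≤ k → a k = 0) (n : ℕ) :
    multichooseSum K a n = multichooseSum K (fun k => a k - a (k + 1)) (n + 1) := by
  cases K with
  | zero => simp [multichooseSum]
  | succ K =>
    have h1 : ∀ k, ((n + (k + 1) - 1).choose (k + 1) : ℝ)
        = ((n + 1 + (k + 1) - 1).choose (k + 1) : ℝ) - ((n + 1 + k - 1).choose k : ℝ) := by
      intro k
      have e1 : n + (k + 1) - 1 = n + k := by omega
      have e2 : n + 1 + (k + 1) - 1 = n + k + 1 := by omega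
      have e3 : n + 1 + k - 1 = n + k := by omega
      rw [e1, e2, e3, Nat.choose_succ_succ' (n + k) k]
      push_cast
      ring
    have h2 : multichooseSum (K + 1) (fun k => a (k + 1)) (n + 1)
        = ∑ k ∈ range K, a (k + 1) * ((n + 1 + k - 1).choose k : ℝ) := by
      rw [multichooseSum, sum_range_succ, ha (K + 1) le_rfl]
      simp
    have h3 : multichooseSum (K + 1) (fun k => a k - a (k + 1)) (n + 1)
        = multichooseSum (K + 1) a (n + 1)
          - multichooseSum (K + 1) (fun k => a (k + 1)) (n + 1) := by
      simp only [multichooseSum, sub_mul, sum_sub_distrib]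
    rw [h3, h2]
    simp only [multichooseSum, sum_range_succ', h1, mul_sub, sum_sub_distrib]
    simp
    ring

/-- The term `n = 0` vanishes because `C(k, k + 1) = 0`; without it the series is `r` times the
negative binomial series. -/
theorem hasSum_multichoose {r : ℝ} (h0 : 0 ≤ r) (h1 : r < 1) (k : ℕ) :
    HasSum (fun n : ℕ => ((n + (k + 1) - 1).choose (k + 1) : ℝ) * r ^ n)
      (r / (1 - r) ^ (k + 2)) := by
  have hr : ‖r‖ < 1 := by rwa [Real.norm_of_nonneg h0]
  have h := (hasSum_choose_mul_geometric_of_norm_lt_one (k + 1) hr).mul_left r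
  rw [← hasSum_nat_add_iff' 1]
  have hf : (fun n : ℕ => ((n + 1 + (k + 1) - 1).choose (k + 1) : ℝ) * r ^ (n + 1))
      = fun n => r * (((n + (k + 1)).choose (k + 1) : ℝ) * r ^ n) := by
    funext n
    have : n + 1 + (k + 1) - 1 = n + (k + 1) := by omega
    rw [this]
    ring
  rw [hf]
  simpa [div_eq_mul_inv] using h

theorem hasSum_multichoose_zero {r : ℝ} (h0 : 0 ≤ r) (h1 : r < 1) :
    HasSum (fun n : ℕ => ((n + 0 - 1).choose 0 : ℝ) * r ^ n) (1 / (1 - r)) := by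
  simpa using hasSum_geometric_of_lt_one h0 h1

/-! ### Uniqueness of decaying solutions -/

/-- The decaying solutions of a second order linear recurrence with characteristic roots `r`
and `φ⁻¹`, `0 < φ ≤ 1`, are determined by their initial value. -/
theorem eq_zero_of_recurrence {x : ℕ → ℝ} {lam mu s r φ : ℝ} (hφ : 0 < φ) (hφ1 : φ ≤ 1)
    (hlam : 0 < lam) (hmu : mu * r = lam * φ) (hs : s * φ = lam * φ ^ 2 + mu)
    (hrec : ∀ n, s * x (n + 1) = lam * x n + mu * x (n + 2))
    (hx : Tendsto x atTop (𝓝 0)) (h0 : x 0 = 0) : ∀ n, x n = 0 := by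
  have hmune : mu ≠ 0 := by
    rintro rfl
    have : 0 < lam * φ := by positivity
    linarith
  -- The difference `x (n + 1) - r * x n` removes the root `r`; what remains is geometric with ratio
  -- `φ⁻¹`, which cannot decay unless it is zero. This also covers `φ = 1`.
  have hd : ∀ n, x (n + 1) - r * x n = φ * (x (n + 2) - r * x (n + 1)) := by
    intro n
    apply mul_left_cancel₀ hmune
    linear_combination φ * hrec n - x (n + 1) * hs - (x n - φ * x (n + 1)) * hmu
  have hpow : ∀ n, x 1 - r * x 0 = φ ^ n * (x (n + 1) - r * x n) := by
    intro n
    induction n with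
    | zero => simp
    | succ n ih => rw [ih, hd n]; ring
  have hlim : Tendsto (fun n => x (n + 1) - r * x n) atTop (𝓝 0) := by
    simpa using ((tendsto_add_atTop_iff_nat 1).2 hx).sub (hx.const_mul r)
  have hzero : x 1 - r * x 0 = 0 := by
    rw [← abs_nonpos_iff]
    have hl := hlim.abs
    rw [abs_zero] at hl
    refine ge_of_tendsto' hl fun n => ?_
    rw [hpow n, abs_mul, abs_of_nonneg (by positivity)]
    exact mul_le_of_le_one_left (abs_nonneg _) (pow_le_one₀ hφ.le hφ1)
  intro n
  induction n with
  | zero => exact h0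
  | succ n ih =>
    have := hpow n
    rw [hzero, ih] at this
    have h2 : φ ^ n ≠ 0 := by positivity
    simpa [h2] using this.symm

theorem sum_Icc_neg_one_one (f : ℤ → ℝ) :
    ∑ Δ ∈ Icc (-1 : ℤ) 1, f Δ = f (-1) + f 0 + f 1 := by
  have : Icc (-1 : ℤ) 1 = {-1, 0, 1} := by decide
  rw [this]
  simp
  ring

/-! ### The quantities `φ_m` and `r_m` -/

namespace ClassM

variable {N : Type*} {M j₀ : ℕ}

theorem alphaTot_nonneg (C : ClassM N M j₀) (m : ℕ) : 0 ≤ C.alphaTot m :=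
  sum_nonneg fun i hi => sum_nonneg fun Δ hΔ => by
    rw [mem_Ioc] at hi
    exact C.alp_nonneg m i hi.1 hi.2 Δ hΔ

theorem discr_nonneg (C : ClassM N M j₀) (m : ℕ) (hl : 0 < C.lam m) (hm : 0 < C.mu m) :
    0 ≤ (C.alphaTot m + C.lam m + C.mu m) ^ 2 - 4 * C.lam m * C.mu m := by
  have := C.alphaTot_nonneg m
  nlinarith [sq_nonneg (C.lam m - C.mu m), mul_nonneg this hl.le, mul_nonneg this hm.le,
    sq_nonneg (C.alphaTot m)]

theorem phi_pos (C : ClassM N M j₀) (m : ℕ) (hl : 0 < C.lam m) (hm : 0 < C.mu m) :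
    0 < C.phi m (C.alphaTot m) := by
  have ha := C.alphaTot_nonneg m
  refine div_pos (sub_pos.2 ?_) (by positivity)
  rw [Real.sqrt_lt' (by positivity)]
  have : 0 < 4 * C.lam m * C.mu m := by positivity
  linarith

theorem phi_le_one (C : ClassM N M j₀) (m : ℕ) (hl : 0 < C.lam m) :
    C.phi m (C.alphaTot m) ≤ 1 := by
  have ha := C.alphaTot_nonneg m
  rw [phi, div_le_one (by positivity)]
  -- The radicand exceeds the square of the left-hand side by `4 α_m λ_m ≥ 0`.
  have : C.alphaTot m + C.mu m - C.lam m
      ≤ √((C.alphaTot m + C.lam m + C.mu m) ^ 2 - 4 * C.lam m * C.mu m) := by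
    apply Real.le_sqrt_of_sq_le
    nlinarith [mul_nonneg ha hl.le]
  linarith

theorem phi_quadratic (C : ClassM N M j₀) (m : ℕ) (hl : 0 < C.lam m) (hm : 0 < C.mu m) :
    (C.lam m + C.mu m + C.alphaTot m) * C.phi m (C.alphaTot m)
      = C.lam m * C.phi m (C.alphaTot m) ^ 2 + C.mu m := by
  have hsq := Real.sq_sqrt (C.discr_nonneg m hl hm)
  rw [phi]
  generalize √((C.alphaTot m + C.lam m + C.mu m) ^ 2 - 4 * C.lam m * C.mu m) = t at hsq
  field_simp
  linear_combination -hsq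

theorem mu_mul_base (C : ClassM N M j₀) (m : ℕ) (hm : 0 < C.mu m) :
    C.mu m * C.base m = C.lam m * C.phi m (C.alphaTot m) := by
  rw [base, if_pos hm, rho]
  field_simp

theorem base_pos (C : ClassM N M j₀) (m : ℕ) (hl : 0 < C.lam m) (hm : 0 < C.mu m) :
    0 < C.base m := by
  have := C.phi_pos m hl hm
  rw [base, if_pos hm, rho]
  positivity

/-! ### The coefficients `c_{m,k}` and their recurrence in `k` -/

/-- The recursion for the coefficient of `C(j - (j₀ + 1) + k, k)` in phase `m`, in terms of the
coefficients `a i u` of the phases `i < m`. -/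
noncomputable def coeffStep (C : ClassM N M j₀) (a : ℕ → ℕ → ℝ) (m k : ℕ) : ℝ :=
  C.Omega m * C.base 0 *
      (∑ u ∈ Ico k m, ∑ i ∈ Ico u m,
        a i u * ∑ Δ ∈ Icc (-1 : ℤ) 1,
          C.alp i (m - i) Δ * C.phi m (C.alphaTot m) ^ (Δ + 1) /
            (1 - C.base 0 * C.phi m (C.alphaTot m)) ^ (u + 1 - k))
    - 1 / C.lam m * (∑ i ∈ Ico k m, a i k * C.alp i (m - i) 1)
    + C.Omega m *
      (∑ i ∈ Ico (k - 1) m,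
        a i (k - 1) * ∑ Δ ∈ Icc (-1 : ℤ) 1,
          C.alp i (m - i) Δ * C.base 0 ^ (-Δ))

theorem coeffStep_congr (C : ClassM N M j₀) {a b : ℕ → ℕ → ℝ} {m : ℕ}
    (h : ∀ i < m, ∀ u, a i u = b i u) (k : ℕ) : C.coeffStep a m k = C.coeffStep b m k := by
  unfold coeffStep
  congr 1
  · congr 2
    · refine sum_congr rfl fun u _ => sum_congr rfl fun i hi => ?_
      rw [h i (mem_Ico.1 hi).2]
    · refine sum_congr rfl fun i hi => ?_
      rw [h i (mem_Ico.1 hi).2]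
  · congr 1
    refine sum_congr rfl fun i hi => ?_
    rw [h i (mem_Ico.1 hi).2]

/-- The coefficients of the stationary probabilities of phase `m`, given the probabilities `p₀` of
the states of level `j₀`. -/
noncomputable def coeff (C : ClassM N M j₀) (p₀ : ℕ → ℝ) (m : ℕ) : ℕ → ℝ := fun k =>
  if k = 0 then p₀ m
  else C.coeffStep (fun i u => if _h : i < m then C.coeff p₀ i u else 0) m k
termination_by m

theorem coeff_zero (C : ClassM N M j₀) (p₀ : ℕ → ℝ) (m : ℕ) : C.coeff p₀ m 0 = p₀ m := by
  rw [coeff, if_pos rfl]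

/-- The guard `i < m` in the definition serves termination only, since `coeffStep` reads no phase
from `m` on. -/
theorem coeff_of_ne_zero (C : ClassM N M j₀) (p₀ : ℕ → ℝ) (m : ℕ) {k : ℕ} (hk : k ≠ 0) :
    C.coeff p₀ m k = C.coeffStep (C.coeff p₀) m k := by
  rw [coeff, if_neg hk]
  exact C.coeffStep_congr (fun i hi u => by simp [hi]) k

/-- For `k > m` all summation ranges are empty. Hence a single recursion holds for every `k ≥ 1`,
with no separate top case. -/
theorem coeff_eq_zero (C : ClassM N M j₀) (p₀ : ℕ → ℝ) (m : ℕ) :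
    ∀ k, m < k → C.coeff p₀ m k = 0 := by
  intro k hk
  rw [coeff_of_ne_zero _ _ _ (by omega), coeffStep, Ico_eq_empty (by omega : ¬ k < m),
    Ico_eq_empty (by omega : ¬ k - 1 < m)]
  simp

theorem coeff_self (C : ClassM N M j₀) (p₀ : ℕ → ℝ) {m : ℕ} (hm : 1 ≤ m) :
    C.coeff p₀ m m = C.coeff p₀ (m - 1) (m - 1) * C.Omega m *
      ∑ Δ ∈ Icc (-1 : ℤ) 1, C.alp (m - 1) 1 Δ * C.base 0 ^ (-Δ) := by
  have h : Ico (m - 1) m = {m - 1} := by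
    ext i
    simp
    omega
  rw [coeff_of_ne_zero _ _ _ (by omega), coeffStep, h, sum_singleton, Nat.sub_sub_self hm]
  simp
  ring

theorem sum_Ico_eq_sum_range {a f : ℕ → ℝ} {m k : ℕ} (h : ∀ i < k, a i = 0) :
    ∑ i ∈ Ico k m, a i * f i = ∑ i ∈ range m, a i * f i := by
  refine sum_subset (fun i hi => mem_range.2 (mem_Ico.1 hi).2) fun i hi hi' => ?_
  rw [mem_range] at hi
  rw [mem_Ico] at hi'
  rw [h i (by omega), zero_mul]

/-- The tail `T k = ∑ u ≥ k, b u / w ^ (u + 1 - k)` solves `w * T k - T (k + 1) = b k` and vanishes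
for large `k`. This is the origin of the double sum in the formula for `c_{m,k}`. -/
theorem tail_sum_recurrence {b : ℕ → ℝ} {m : ℕ} (hb : ∀ u, m ≤ u → b u = 0) {w : ℝ} (hw : w ≠ 0)
    (k : ℕ) :
    w * (∑ u ∈ Ico k m, b u / w ^ (u + 1 - k)) - ∑ u ∈ Ico (k + 1) m, b u / w ^ (u + 1 - (k + 1))
      = b k := by
  by_cases hk : k < m
  · rw [sum_eq_sum_Ico_succ_bot hk, mul_add, mul_sum, add_sub_assoc, ← sum_sub_distrib,
      sum_eq_zero, Nat.add_sub_cancel_left]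
    · field_simp
      simp
    · intro u hu
      rw [mem_Ico] at hu
      have : u + 1 - k = (u + 1 - (k + 1)) + 1 := by omega
      rw [this, pow_succ]
      field_simp
      simp
  · rw [Ico_eq_empty hk, Ico_eq_empty (by omega : ¬ k + 1 < m), hb k (by omega)]
    simp

/-- As `c_{i,u} = 0` for `i < u`, every inner sum may run over all `i < m`; the sums for different
`k` then combine term by term. -/
theorem coeff_succ (C : ClassM N M j₀) (p₀ : ℕ → ℝ) (m k : ℕ) :
    C.coeff p₀ m (k + 1) =
      C.Omega m * C.base 0 * (∑ u ∈ Ico (k + 1) m,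
        (∑ i ∈ range m, C.coeff p₀ i u * (C.alp i (m - i) (-1)
          + C.alp i (m - i) 0 * C.phi m (C.alphaTot m)
          + C.alp i (m - i) 1 * C.phi m (C.alphaTot m) ^ 2)) /
            (1 - C.base 0 * C.phi m (C.alphaTot m)) ^ (u + 1 - (k + 1)))
      - 1 / C.lam m * (∑ i ∈ range m, C.coeff p₀ i (k + 1) * C.alp i (m - i) 1)
      + C.Omega m * (∑ i ∈ range m, C.coeff p₀ i k * (C.alp i (m - i) (-1) * C.base 0
          + C.alp i (m - i) 0 + C.alp i (m - i) 1 / C.base 0)) := by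
  rw [coeff_of_ne_zero _ _ _ (by omega), coeffStep, Nat.add_sub_cancel]
  rw [sum_Ico_eq_sum_range (fun i hi => C.coeff_eq_zero p₀ i _ hi),
    sum_Ico_eq_sum_range (fun i hi => C.coeff_eq_zero p₀ i _ hi)]
  congr 1
  · congr 2
    refine sum_congr rfl fun u _ => ?_
    rw [sum_Ico_eq_sum_range (fun i hi => C.coeff_eq_zero p₀ i _ hi), sum_div]
    refine sum_congr rfl fun i _ => ?_
    rw [sum_Icc_neg_one_one, mul_div_assoc]
    norm_num
    norm_cast
    ring
  · congr 1
    refine sum_congr rfl fun i _ => ?_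
    rw [sum_Icc_neg_one_one]
    norm_num
    left
    field_simp

/-- This is the balance equation above `j₀` read off at the coefficient of `C(n + 1 + k, k)`, with
phase `m` on the left and the inflow from lower phases on the right. -/
theorem coeff_recurrence (C : ClassM N M j₀) (p₀ : ℕ → ℝ) (m k : ℕ) (hl : 0 < C.lam m)
    (hr : 0 < C.base 0) (hb : C.base m = C.base 0)
    (hw : 1 - C.base 0 * C.phi m (C.alphaTot m) ≠ 0) :
    C.lam m * ((1 - C.base 0 * C.phi m (C.alphaTot m)) * C.coeff p₀ m (k + 1)
        - C.coeff p₀ m (k + 2)) =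
      ∑ i ∈ range m,
        (C.alp i (m - i) (-1) * C.base 0 ^ 2 * C.coeff p₀ i k
          + C.alp i (m - i) 0 * C.base 0 * (C.coeff p₀ i k - C.coeff p₀ i (k + 1))
          + C.alp i (m - i) 1 *
            (C.coeff p₀ i k - 2 * C.coeff p₀ i (k + 1) + C.coeff p₀ i (k + 2))) := by
  have htail := tail_sum_recurrence
    (b := fun u => ∑ i ∈ range m, C.coeff p₀ i u * (C.alp i (m - i) (-1)
          + C.alp i (m - i) 0 * C.phi m (C.alphaTot m)
          + C.alp i (m - i) 1 * C.phi m (C.alphaTot m) ^ 2)) (m := m)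
    (fun u hu => sum_eq_zero fun i hi => by
      rw [C.coeff_eq_zero p₀ i u (by rw [mem_range] at hi; omega), zero_mul]) hw (k + 1)
  have hΩ : C.lam m * (1 - C.base 0 * C.phi m (C.alphaTot m)) * C.Omega m = C.base 0 := by
    rw [Omega, hb]
    field_simp
  rw [coeff_succ C p₀ m k, coeff_succ C p₀ m (k + 1)]
  set T := ∑ u ∈ Ico (k + 1) m,
        (∑ i ∈ range m, C.coeff p₀ i u * (C.alp i (m - i) (-1)
          + C.alp i (m - i) 0 * C.phi m (C.alphaTot m)
          + C.alp i (m - i) 1 * C.phi m (C.alphaTot m) ^ 2)) /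
            (1 - C.base 0 * C.phi m (C.alphaTot m)) ^ (u + 1 - (k + 1))
  set T' := ∑ u ∈ Ico (k + 1 + 1) m,
        (∑ i ∈ range m, C.coeff p₀ i u * (C.alp i (m - i) (-1)
          + C.alp i (m - i) 0 * C.phi m (C.alphaTot m)
          + C.alp i (m - i) 1 * C.phi m (C.alphaTot m) ^ 2)) /
            (1 - C.base 0 * C.phi m (C.alphaTot m)) ^ (u + 1 - (k + 1 + 1))
  set Y : ℕ → ℝ := fun i => C.alp i (m - i) (-1) * C.base 0
          + C.alp i (m - i) 0 + C.alp i (m - i) 1 / C.base 0 with hY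
  set w := 1 - C.base 0 * C.phi m (C.alphaTot m) with hwdef
  have key : C.lam m * C.Omega m = C.base 0 / w := by
    rw [eq_div_iff hw]
    linear_combination hΩ
  -- Isolates `λ_m Ω_m = r_0 / w` and the combination `w * T - T'`, which telescopes by `htail`. The
  -- rest is an identity for each `i` separately.
  have expand : C.lam m * (w * (C.Omega m * C.base 0 * T
        - 1 / C.lam m * (∑ i ∈ range m, C.coeff p₀ i (k + 1) * C.alp i (m - i) 1)
        + C.Omega m * (∑ i ∈ range m, C.coeff p₀ i k * Y i))
      - (C.Omega m * C.base 0 * T'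
        - 1 / C.lam m * (∑ i ∈ range m, C.coeff p₀ i (k + 1 + 1) * C.alp i (m - i) 1)
        + C.Omega m * (∑ i ∈ range m, C.coeff p₀ i (k + 1) * Y i))) =
      (C.lam m * C.Omega m) * C.base 0 * (w * T - T')
        - w * (∑ i ∈ range m, C.coeff p₀ i (k + 1) * C.alp i (m - i) 1)
        + (∑ i ∈ range m, C.coeff p₀ i (k + 2) * C.alp i (m - i) 1)
        + (C.lam m * C.Omega m) * w * (∑ i ∈ range m, C.coeff p₀ i k * Y i)
        - (C.lam m * C.Omega m) * (∑ i ∈ range m, C.coeff p₀ i (k + 1) * Y i) := by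
    field_simp
    ring
  rw [expand, htail, key]
  simp only [mul_sum]
  rw [← sum_sub_distrib, ← sum_add_distrib, ← sum_add_distrib, ← sum_sub_distrib]
  refine sum_congr rfl fun i _ => ?_
  simp only [hY]
  field_simp
  rw [hwdef]
  ring

/-! ### Solution of the balance equations above level `j₀` -/

/-- A combination of binomial coefficients and powers of the base with the coefficients `coeff`
satisfies the balance equations of the levels above `j₀`. -/
theorem coeff_balance (C : ClassM N M j₀) (p₀ : ℕ → ℝ) {m : ℕ} (hm : m ≤ M) (n : ℕ)
    (hl : 0 < C.lam m) (hmu : 0 < C.mu m) (hr : 0 < C.base 0) (hb : C.base m = C.base 0)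
    (hw : 1 - C.base 0 * C.phi m (C.alphaTot m) ≠ 0) :
    (C.lam m + C.mu m + C.alphaTot m) *
        (multichooseSum (M + 1) (C.coeff p₀ m) (n + 1) * C.base 0 ^ (n + 1)) =
      C.lam m * (multichooseSum (M + 1) (C.coeff p₀ m) n * C.base 0 ^ n)
      + C.mu m * (multichooseSum (M + 1) (C.coeff p₀ m) (n + 2) * C.base 0 ^ (n + 2))
      + ∑ i ∈ range m,
        (C.alp i (m - i) 1 * (multichooseSum (M + 1) (C.coeff p₀ i) n * C.base 0 ^ n)
        + C.alp i (m - i) 0 * (multichooseSum (M + 1) (C.coeff p₀ i) (n + 1) * C.base 0 ^ (n + 1))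
        + C.alp i (m - i) (-1) *
          (multichooseSum (M + 1) (C.coeff p₀ i) (n + 2) * C.base 0 ^ (n + 2))) := by
  -- All three levels are expanded in the binomials of level `n + 2`, so that coefficients can be
  -- compared.
  have shift1 : ∀ i ≤ M, multichooseSum (M + 1) (C.coeff p₀ i) (n + 1)
      = ∑ k ∈ range (M + 1), ((n + 2 + k - 1).choose k : ℝ) *
          (C.coeff p₀ i k - C.coeff p₀ i (k + 1)) := by
    intro i hi
    rw [multichooseSum_eq_succ (fun k hk => C.coeff_eq_zero p₀ i k (by omega))]
    exact sum_congr rfl fun k _ => mul_comm _ _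
  have shift0 : ∀ i ≤ M, multichooseSum (M + 1) (C.coeff p₀ i) n
      = ∑ k ∈ range (M + 1), ((n + 2 + k - 1).choose k : ℝ) *
          (C.coeff p₀ i k - 2 * C.coeff p₀ i (k + 1) + C.coeff p₀ i (k + 2)) := by
    intro i hi
    rw [multichooseSum_eq_succ (fun k hk => C.coeff_eq_zero p₀ i k (by omega)),
      multichooseSum_eq_succ (fun k hk => by
        rw [C.coeff_eq_zero p₀ i k (by omega), C.coeff_eq_zero p₀ i (k + 1) (by omega), sub_zero])]
    exact sum_congr rfl fun k _ => by ring
  have shift2 : ∀ i, multichooseSum (M + 1) (C.coeff p₀ i) (n + 2)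
      = ∑ k ∈ range (M + 1), ((n + 2 + k - 1).choose k : ℝ) * C.coeff p₀ i k :=
    fun i => sum_congr rfl fun k _ => mul_comm _ _
  have hφ := C.phi_pos m hl hmu
  have hq := C.phi_quadratic m hl hmu
  have hmb := C.mu_mul_base m hmu
  rw [hb] at hmb
  -- The base is a characteristic root, which cancels the `c_{m,k}` terms of phase `m`; this is why
  -- only `c_{m,k+1}` and `c_{m,k+2}` survive in `coeff_recurrence`.
  have hchar : (C.lam m + C.mu m + C.alphaTot m) * C.base 0 = C.lam m + C.mu m * C.base 0 ^ 2 := by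
    apply mul_left_cancel₀ hmu.ne'
    linear_combination (C.lam m) * hq + (C.lam m + C.mu m + C.alphaTot m) * hmb
      - (C.mu m * C.base 0 + C.lam m * C.phi m (C.alphaTot m)) * hmb
  have hsource : ∑ i ∈ range m,
        (C.alp i (m - i) 1 * (multichooseSum (M + 1) (C.coeff p₀ i) n * C.base 0 ^ n)
        + C.alp i (m - i) 0 * (multichooseSum (M + 1) (C.coeff p₀ i) (n + 1) * C.base 0 ^ (n + 1))
        + C.alp i (m - i) (-1) *
          (multichooseSum (M + 1) (C.coeff p₀ i) (n + 2) * C.base 0 ^ (n + 2)))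
      = C.base 0 ^ n * ∑ k ∈ range (M + 1), ((n + 2 + k - 1).choose k : ℝ) *
        (C.lam m * ((1 - C.base 0 * C.phi m (C.alphaTot m)) * C.coeff p₀ m (k + 1)
        - C.coeff p₀ m (k + 2))) := by
    simp only [C.coeff_recurrence p₀ m _ hl hr hb hw]
    simp only [mul_sum]
    rw [sum_comm]
    refine sum_congr rfl fun i hi => ?_
    have hi' : i ≤ M := by
      rw [mem_range] at hi
      omega
    rw [shift0 i hi', shift1 i hi', shift2 i]
    simp only [sum_mul, mul_sum]
    rw [← sum_add_distrib, ← sum_add_distrib]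
    refine sum_congr rfl fun k _ => ?_
    ring
  rw [hsource, shift0 m hm, shift1 m hm, shift2 m]
  simp only [sum_mul, mul_sum]
  rw [← sum_add_distrib, ← sum_add_distrib]
  refine sum_congr rfl fun k _ => ?_
  linear_combination (((n + 2 + k - 1).choose k : ℝ) * C.base 0 ^ n) *
    ((C.coeff p₀ m k - C.coeff p₀ m (k + 1)) * hchar
      - C.base 0 * C.coeff p₀ m (k + 1) * hmb)

theorem tendsto_multichooseSum_mul_pow (K : ℕ) (a : ℕ → ℝ) {r : ℝ} (h0 : 0 ≤ r) (h1 : r < 1) :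
    Tendsto (fun n => multichooseSum K a n * r ^ n) atTop (𝓝 0) := by
  have : Tendsto (fun n : ℕ => ∑ k ∈ range K, a k * (((n + k - 1).choose k : ℝ) * r ^ n)) atTop
      (𝓝 (∑ k ∈ range K, a k * 0)) := by
    refine tendsto_finsetSum _ fun k _ => Tendsto.const_mul _ ?_
    cases k with
    | zero => exact (hasSum_multichoose_zero h0 h1).summable.tendsto_atTop_zero
    | succ k => exact (hasSum_multichoose h0 h1 k).summable.tendsto_atTop_zero
  simpa [multichooseSum, sum_mul, mul_assoc] using this

/-- The decaying solution of the balance equations of the levels above `j₀`. -/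
theorem eq_multichooseSum_of_balance (C : ClassM N M j₀)
    (hpos : ∀ m ≤ M, 0 < C.lam m ∧ 0 < C.mu m) (hbase : ∀ m ≤ M, C.base m = C.base 0)
    (hr1 : C.base 0 < 1) (p : ℕ → ℕ → ℝ)
    (hlim : ∀ m ≤ M, Tendsto (p m) atTop (𝓝 0))
    (hp : ∀ m ≤ M, ∀ n, (C.lam m + C.mu m + C.alphaTot m) * p m (n + 1) =
      C.lam m * p m n + C.mu m * p m (n + 2)
      + ∑ i ∈ range m, (C.alp i (m - i) 1 * p i n + C.alp i (m - i) 0 * p i (n + 1)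
        + C.alp i (m - i) (-1) * p i (n + 2))) :
    ∀ m ≤ M, ∀ n, p m n
      = multichooseSum (M + 1) (C.coeff (fun i => p i 0) m) n * C.base 0 ^ n := by
  have hr := C.base_pos 0 (hpos 0 (Nat.zero_le _)).1 (hpos 0 (Nat.zero_le _)).2
  intro m
  induction m using Nat.strong_induction_on with
  | _ m ih =>
    intro hm
    obtain ⟨hl, hmu⟩ := hpos m hm
    have hφ := C.phi_pos m hl hmu
    have hφ1 := C.phi_le_one m hl
    have hw : 1 - C.base 0 * C.phi m (C.alphaTot m) ≠ 0 := by
      have : C.base 0 * C.phi m (C.alphaTot m) < 1 := mul_lt_one_of_nonneg_of_lt_one_left hr.le hr1 hφ1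
      linarith
    have hmb := C.mu_mul_base m hmu
    rw [hbase m hm] at hmb
    -- By induction the inflow from lower phases is the same for `p` and for the candidate, so their
    -- difference solves the homogeneous recurrence.
    have hzero := eq_zero_of_recurrence
      (x := fun n => p m n
        - multichooseSum (M + 1) (C.coeff (fun i => p i 0) m) n * C.base 0 ^ n)
      hφ hφ1 hl hmb (C.phi_quadratic m hl hmu) ?_ ?_ ?_
    · exact fun n => sub_eq_zero.1 (hzero n)
    · intro n
      have h1 := hp m hm n
      have h2 := C.coeff_balance (fun i => p i 0) hm n hl hmu hr (hbase m hm) hw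
      have h3 : ∑ i ∈ range m, (C.alp i (m - i) 1 * p i n + C.alp i (m - i) 0 * p i (n + 1)
        + C.alp i (m - i) (-1) * p i (n + 2)) = _ :=
        sum_congr rfl fun i hi => by
          have hi' := mem_range.1 hi
          rw [ih i hi' (by omega) n, ih i hi' (by omega) (n + 1), ih i hi' (by omega) (n + 2)]
      rw [h3] at h1
      linear_combination h1 - h2
    · simpa using (hlim m hm).sub (tendsto_multichooseSum_mul_pow _ _ hr.le hr1)
    · have : multichooseSum (M + 1) (C.coeff (fun i => p i 0) m) 0 = p m 0 := by
        rw [multichooseSum, sum_range_succ', coeff_zero, sum_eq_zero]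
        · simp
        · intro k _
          simp
      simp [this]

end ClassM

/-! ### Sums over states and over phases -/

theorem hasSum_of_three {F : ℕ → ℝ} (n : ℕ)
    (h : ∀ l, l ≠ n → l ≠ n + 1 → l ≠ n + 2 → F l = 0) :
    HasSum F (F n + F (n + 1) + F (n + 2)) := by
  have : HasSum F (∑ l ∈ {n, n + 1, n + 2}, F l) := hasSum_sum_of_ne_finset_zero (fun l hl => by
    simp only [mem_insert, mem_singleton, not_or] at hl
    exact h l hl.1 hl.2.1 hl.2.2)
  rwa [sum_insert (by simp), sum_insert (by simp), sum_singleton, ← add_assoc] at this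

theorem hasSum_of_two {F : ℕ → ℝ} (h : ∀ l, l ≠ 0 → l ≠ 1 → F l = 0) :
    HasSum F (F 0 + F 1) := by
  have : HasSum F (∑ l ∈ {0, 1}, F l) := hasSum_sum_of_ne_finset_zero (fun l hl => by
    simp only [mem_insert, mem_singleton, not_or] at hl
    exact h l hl.1 hl.2)
  rwa [sum_insert (by simp), sum_singleton] at this

/-- A sum over the states is the sum over the non-repeating portion plus the sums over the
phases. -/
theorem hasSum_state {N : Type*} [Fintype N] {M j₀ : ℕ} {g : State N M j₀ → ℝ}
    {s : Fin (M + 1) → ℝ}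
    (h : ∀ m, HasSum (fun n => g (State.rep m (j₀ + n) (Nat.le_add_right _ _))) (s m)) :
    HasSum g (∑ x : N, g (Sum.inl x) + ∑ m, s m) := by
  refine HasSum.sum (hasSum_fintype _) ?_
  have hsplit : g ∘ Sum.inr = fun y : Fin (M + 1) × {j : ℕ // j₀ ≤ j} =>
      ∑ m, if y.1 = m then g (Sum.inr y) else 0 := by
    funext y
    simp
  rw [hsplit]
  refine hasSum_sum fun m _ => ?_
  have hinj : Function.Injective
      (fun n : ℕ => ((m, ⟨j₀ + n, Nat.le_add_right _ _⟩) : Fin (M + 1) × {j : ℕ // j₀ ≤ j})) := by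
    intro a b hab
    simpa using hab
  refine (hinj.hasSum_iff ?_).1 ?_
  · rintro ⟨i, j, hj⟩ hy
    refine if_neg ?_
    rintro rfl
    exact hy ⟨j - j₀, by simp [Nat.add_sub_cancel' hj]⟩
  · simpa [Function.comp_def] using h m

/-- Phases never decrease within the repeating portion: this form serves outgoing rates, and its
`Iio` counterpart incoming ones. -/
theorem sum_eq_add_sum_Ioi {M : ℕ} (m : Fin (M + 1)) {f B : Fin (M + 1) → ℝ} {A : ℝ}
    (hA : f m = A) (hB : ∀ i, m < i → f i = B i) (h0 : ∀ i, i < m → f i = 0) :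
    ∑ i, f i = A + ∑ i ∈ Ioi m, B i := by
  have : ∀ i, f i = (if i = m then A else 0) + if m < i then B i else 0 := by
    intro i
    rcases lt_trichotomy i m with h | rfl | h
    · rw [h0 i h, if_neg h.ne, if_neg h.not_gt, add_zero]
    · rw [if_pos rfl, if_neg (lt_irrefl _), add_zero, hA]
    · rw [hB i h, if_neg h.ne', if_pos h, zero_add]
  simp_rw [this]
  rw [sum_add_distrib, sum_ite_eq' univ m, if_pos (mem_univ m), ← sum_filter,
    filter_lt_eq_Ioi]

theorem sum_eq_add_sum_Iio {M : ℕ} (m : Fin (M + 1)) {f B : Fin (M + 1) → ℝ} {A : ℝ}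
    (hA : f m = A) (hB : ∀ i, i < m → f i = B i) (h0 : ∀ i, m < i → f i = 0) :
    ∑ i, f i = A + ∑ i ∈ Iio m, B i := by
  have : ∀ i, f i = (if i = m then A else 0) + if i < m then B i else 0 := by
    intro i
    rcases lt_trichotomy i m with h | rfl | h
    · rw [hB i h, if_neg h.ne, if_pos h, zero_add]
    · rw [if_pos rfl, if_neg (lt_irrefl _), add_zero, hA]
    · rw [h0 i h, if_neg h.ne', if_neg h.not_gt, add_zero]
  simp_rw [this]
  rw [sum_add_distrib, sum_ite_eq' univ m, if_pos (mem_univ m), ← sum_filter,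
    filter_gt_eq_Iio]

theorem sum_Iio_fin {M : ℕ} (m : Fin (M + 1)) (f : ℕ → ℝ) :
    ∑ i ∈ Iio m, f i = ∑ i ∈ range m, f i := by
  rw [← Nat.Iio_eq_range, ← Fin.map_valEmbedding_Iio, sum_map]
  rfl

theorem sum_Ioi_fin {M : ℕ} (m : Fin (M + 1)) (f : ℕ → ℝ) :
    ∑ i ∈ Ioi m, f i = ∑ i ∈ Ioc (m : ℕ) M, f i := by
  have : Ioc (m : ℕ) M = (Ioi m).map Fin.valEmbedding := by
    rw [Fin.map_valEmbedding_Ioi]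
    ext i
    simp
  rw [this, sum_map]
  rfl

/-! ### Transition rates and total flows -/

namespace ClassM

variable {N : Type*} {M j₀ : ℕ}

theorem rate_rep (C : ClassM N M j₀) (m i : Fin (M + 1)) (n l : ℕ) (hn : j₀ ≤ j₀ + n)
    (hl : j₀ ≤ j₀ + l) :
    C.rate (State.rep m (j₀ + n) hn) (State.rep i (j₀ + l) hl) =
      if i = m then if l = n + 1 then C.lam m else if n = l + 1 then C.mu m else 0
      else if m < i ∧ |(l : ℤ) - n| ≤ 1 then C.alp m (i - m) ((l : ℤ) - n) else 0 := by
  have h1 : j₀ + l = j₀ + n + 1 ↔ l = n + 1 := by omega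
  have h2 : j₀ + n = j₀ + l + 1 ↔ n = l + 1 := by omega
  simp only [rate, h1, h2]
  push_cast
  simp only [add_sub_add_left_eq_sub]

theorem rate_rep_eq_zero (C : ClassM N M j₀) (m i : Fin (M + 1)) (n l : ℕ) (hn : j₀ ≤ j₀ + n)
    (hl : j₀ ≤ j₀ + l) 
    (h : n + 1 < l ∨ l + 1 < n ∨ (i : ℕ) < m ∨ ((i : ℕ) = m ∧ n = l)) :
    C.rate (State.rep m (j₀ + n) hn) (State.rep i (j₀ + l) hl) = 0 := by
  rw [rate_rep]
  split_ifs with h1 h2 h3 h4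
  · subst h1
    omega
  · subst h1
    omega
  · rfl
  · have h5 := abs_le.1 h4.2
    have h6 : (m : ℕ) < i := h4.1
    omega
  · rfl

theorem rate_rep_up (C : ClassM N M j₀) (m : Fin (M + 1)) (n : ℕ) (hn : j₀ ≤ j₀ + n)
    (hl : j₀ ≤ j₀ + (n + 1)) :
    C.rate (State.rep m (j₀ + n) hn) (State.rep m (j₀ + (n + 1)) hl) = C.lam m := by
  simp [rate_rep]

theorem rate_rep_down (C : ClassM N M j₀) (m : Fin (M + 1)) (n : ℕ) (hn : j₀ ≤ j₀ + (n + 1))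
    (hl : j₀ ≤ j₀ + n) :
    C.rate (State.rep m (j₀ + (n + 1)) hn) (State.rep m (j₀ + n) hl) = C.mu m := by
  simp only [rate_rep, if_true]
  rw [if_neg (by omega)]

theorem rate_rep_phase (C : ClassM N M j₀) {m i : Fin (M + 1)} (h : m < i) (n l : ℕ) (Δ : ℤ)
    (hΔ : (l : ℤ) - n = Δ) (hΔ1 : |Δ| ≤ 1) (hn : j₀ ≤ j₀ + n) (hl : j₀ ≤ j₀ + l) :
    C.rate (State.rep m (j₀ + n) hn) (State.rep i (j₀ + l) hl) = C.alp m (i - m) Δ := by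
  rw [rate_rep, if_neg h.ne', hΔ, if_pos ⟨h, hΔ1⟩]

theorem rate_nonneg (C : ClassM N M j₀) (x y : State N M j₀) : 0 ≤ C.rate x y := by
  rcases x with x | ⟨m, j, hj⟩ <;> rcases y with y | ⟨i, l, hl⟩
  · exact C.qNN_nonneg x y
  · simp only [rate]
    split_ifs
    exacts [C.qNR_nonneg _ _, le_rfl]
  · simp only [rate]
    split_ifs
    exacts [C.qRN_nonneg _ _, le_rfl]
  · simp only [rate]
    split_ifs with h1 h2 h3 h4
    · exact C.lam_nonneg m (Nat.lt_succ_iff.1 m.2)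
    · exact C.mu_nonneg m (Nat.lt_succ_iff.1 m.2)
    · exact le_rfl
    · exact C.alp_nonneg m i h4.1 (Nat.lt_succ_iff.1 i.2) _ (mem_Icc.2 (abs_le.1 h4.2))
    · exact le_rfl

theorem IsStationary.tendsto_zero {C : ClassM N M j₀} {π : State N M j₀ → ℝ}
    (hπ : C.IsStationary π) (m : Fin (M + 1)) :
    Tendsto (fun n => π (State.rep m (j₀ + n) (Nat.le_add_right _ _))) atTop (𝓝 0) := by
  refine (hπ.hasSum_one.summable.comp_injective
    (i := fun n : ℕ => State.rep m (j₀ + n) (Nat.le_add_right _ _)) ?_).tendsto_atTop_zero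
  intro a b hab
  simpa using hab

variable [Fintype N]

theorem hasSum_out_succ (C : ClassM N M j₀) (m : Fin (M + 1)) (n : ℕ) :
    HasSum (fun y => C.rate (State.rep m (j₀ + (n + 1)) (Nat.le_add_right _ _)) y)
      (C.lam m + C.mu m + C.alphaTot m) := by
  have hphase : ∀ i : Fin (M + 1), HasSum (fun l => C.rate (State.rep m (j₀ + (n + 1))
      (Nat.le_add_right _ _)) (State.rep i (j₀ + l) (Nat.le_add_right _ _))) _ :=
    fun i => hasSum_of_three n fun l h0 h1 h2 => C.rate_rep_eq_zero _ _ _ _ _ _ (by omega)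
  have h := hasSum_state hphase
  convert h using 1
  have hN : ∑ x : N, C.rate (State.rep m (j₀ + (n + 1)) (Nat.le_add_right _ _)) (Sum.inl x) = 0 :=
    sum_eq_zero fun x _ => by simp [rate]
  rw [hN, zero_add, sum_eq_add_sum_Ioi m (A := C.lam m + C.mu m)
    (B := fun i => ∑ Δ ∈ Icc (-1 : ℤ) 1, C.alp m (i - m) Δ), alphaTot,
    sum_Ioi_fin m (fun i => ∑ Δ ∈ Icc (-1 : ℤ) 1, C.alp m (i - m) Δ)]
  · rw [C.rate_rep_down, C.rate_rep_eq_zero _ _ _ _ _ _ (by simp), C.rate_rep_up]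
    ring
  · intro i hi
    rw [sum_Icc_neg_one_one, C.rate_rep_phase hi _ _ (-1) (by push_cast; ring) (by simp),
      C.rate_rep_phase hi _ _ 0 (by push_cast; ring) (by simp),
      C.rate_rep_phase hi _ _ 1 (by push_cast; ring) (by simp)]
  · intro i hi
    simp [C.rate_rep_eq_zero _ _ _ _ _ _ (Or.inr (Or.inr (Or.inl hi)))]

theorem hasSum_in_succ (C : ClassM N M j₀) (π : State N M j₀ → ℝ) (m : Fin (M + 1)) (n : ℕ) :
    HasSum (fun y => π y * C.rate y (State.rep m (j₀ + (n + 1)) (Nat.le_add_right _ _)))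
      (C.lam m * π (State.rep m (j₀ + n) (Nat.le_add_right _ _))
        + C.mu m * π (State.rep m (j₀ + (n + 2)) (Nat.le_add_right _ _))
        + ∑ i ∈ Iio m, (C.alp i (m - i) 1 * π (State.rep i (j₀ + n) (Nat.le_add_right _ _))
          + C.alp i (m - i) 0 * π (State.rep i (j₀ + (n + 1)) (Nat.le_add_right _ _))
          + C.alp i (m - i) (-1) * π (State.rep i (j₀ + (n + 2)) (Nat.le_add_right _ _)))) := by
  have hphase : ∀ i : Fin (M + 1), HasSum (fun l => π (State.rep i (j₀ + l)
      (Nat.le_add_right _ _)) * C.rate (State.rep i (j₀ + l)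
      (Nat.le_add_right _ _)) (State.rep m (j₀ + (n + 1)) (Nat.le_add_right _ _))) _ :=
    fun i => hasSum_of_three n fun l h0 h1 h2 => by
      rw [C.rate_rep_eq_zero _ _ _ _ _ _ (by omega), mul_zero]
  have h := hasSum_state (g := fun y => π y *
    C.rate y (State.rep m (j₀ + (n + 1)) (Nat.le_add_right _ _))) hphase
  convert h using 1
  have hN : ∑ x : N, π (Sum.inl x) *
      C.rate (Sum.inl x) (State.rep m (j₀ + (n + 1)) (Nat.le_add_right _ _)) = 0 :=
    sum_eq_zero fun x _ => by simp [rate]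
  rw [hN, zero_add]
  symm
  apply sum_eq_add_sum_Iio
  · rw [C.rate_rep_up, C.rate_rep_eq_zero _ _ _ _ _ _ (by simp), C.rate_rep_down]
    ring
  · intro i hi
    rw [C.rate_rep_phase hi _ _ 1 (by push_cast; ring) (by simp),
      C.rate_rep_phase hi _ _ 0 (by push_cast; ring) (by simp),
      C.rate_rep_phase hi _ _ (-1) (by push_cast; ring) (by simp)]
    ring
  · intro i hi
    simp [C.rate_rep_eq_zero _ _ _ _ _ _ (Or.inr (Or.inr (Or.inl hi)))]

theorem hasSum_out_zero (C : ClassM N M j₀) (m : Fin (M + 1)) :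
    HasSum (fun y => C.rate (State.rep m j₀ le_rfl) y)
      (C.lam m + (∑ i ∈ Ioi m, (C.alp m (i - m) 0 + C.alp m (i - m) 1))
        + ∑ x : N, C.rate (State.rep m j₀ le_rfl) (Sum.inl x)) := by
  -- Writing the level as `j₀ + 0` makes the lemmas on `rate` applicable. At this level `Δ = -1` is
  -- impossible, so only two target levels remain.
  have hphase : ∀ i : Fin (M + 1), HasSum (fun l => C.rate (State.rep m (j₀ + 0)
      (Nat.le_add_right _ _)) (State.rep i (j₀ + l) (Nat.le_add_right _ _))) _ :=
    fun i => hasSum_of_two fun l h0 h1 => C.rate_rep_eq_zero _ _ _ _ _ _ (by omega)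
  have h := hasSum_state hphase
  rw [sum_eq_add_sum_Ioi m (A := C.lam m)
    (B := fun i => C.alp m (i - m) 0 + C.alp m (i - m) 1), add_comm (∑ x : N, _) _] at h
  · exact h
  · rw [C.rate_rep_eq_zero _ _ _ _ _ _ (by simp), C.rate_rep_up, zero_add]
  · intro i hi
    rw [C.rate_rep_phase hi _ _ 0 (by simp) (by simp),
      C.rate_rep_phase hi _ _ 1 (by simp) (by simp)]
  · intro i hi
    rw [C.rate_rep_eq_zero _ _ _ _ _ _ (Or.inr (Or.inr (Or.inl hi))),
      C.rate_rep_eq_zero _ _ _ _ _ _ (Or.inr (Or.inr (Or.inl hi))), add_zero]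

theorem hasSum_in_zero (C : ClassM N M j₀) (π : State N M j₀ → ℝ) (m : Fin (M + 1)) :
    HasSum (fun y => π y * C.rate y (State.rep m j₀ le_rfl))
      (C.mu m * π (State.rep m (j₀ + 1) (Nat.le_add_right _ _))
        + (∑ x : N, C.rate (Sum.inl x) (State.rep m j₀ le_rfl) * π (Sum.inl x))
        + ∑ i ∈ Iio m,
          (C.alp i (m - i) (-1) * π (State.rep i (j₀ + 1) (Nat.le_add_right _ _))
            + C.alp i (m - i) 0 * π (State.rep i j₀ le_rfl))) := by
  have hphase : ∀ i : Fin (M + 1), HasSum (fun l => π (State.rep i (j₀ + l)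
      (Nat.le_add_right _ _)) * C.rate (State.rep i (j₀ + l)
      (Nat.le_add_right _ _)) (State.rep m (j₀ + 0) (Nat.le_add_right _ _))) _ :=
    fun i => hasSum_of_two fun l h0 h1 => by
      rw [C.rate_rep_eq_zero _ _ _ _ _ _ (by omega), mul_zero]
  have h := hasSum_state (g := fun y => π y *
    C.rate y (State.rep m (j₀ + 0) (Nat.le_add_right _ _))) hphase
  rw [sum_eq_add_sum_Iio m (A := C.mu m * π (State.rep m (j₀ + 1) (Nat.le_add_right _ _)))
    (B := fun i => C.alp i (m - i) (-1) * π (State.rep i (j₀ + 1) (Nat.le_add_right _ _))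
            + C.alp i (m - i) 0 * π (State.rep i j₀ le_rfl)), ← add_assoc,
    add_comm (∑ x : N, _)] at h
  · simp only [mul_comm (π (Sum.inl _))] at h
    exact h
  · rw [C.rate_rep_eq_zero _ _ _ _ _ _ (by simp), C.rate_rep_down]
    ring
  · intro i hi
    rw [C.rate_rep_phase hi _ _ 0 (by simp) (by simp),
      C.rate_rep_phase hi _ _ (-1) (by simp) (by simp)]
    simp only [add_zero]
    ring
  · intro i hi
    rw [C.rate_rep_eq_zero _ _ _ _ _ _ (Or.inr (Or.inr (Or.inl hi))),
      C.rate_rep_eq_zero _ _ _ _ _ _ (Or.inr (Or.inr (Or.inl hi))), mul_zero, mul_zero, add_zero]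

theorem hasSum_out_inl (C : ClassM N M j₀) (x : N) :
    HasSum (fun y => C.rate (Sum.inl x) y)
      ((∑ m : Fin (M + 1), C.rate (Sum.inl x) (State.rep m j₀ le_rfl))
        + ∑ y : N, C.rate (Sum.inl x) (Sum.inl y)) := by
  rw [add_comm (∑ m : Fin (M + 1), _) _]
  refine hasSum_state fun m => hasSum_single 0 fun l hl => ?_
  simp [rate, hl]

theorem hasSum_in_inl (C : ClassM N M j₀) (π : State N M j₀ → ℝ) (x : N) :
    HasSum (fun y => π y * C.rate y (Sum.inl x))
      ((∑ m : Fin (M + 1), C.rate (State.rep m j₀ le_rfl) (Sum.inl x)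
          * π (State.rep m j₀ le_rfl))
        + ∑ y : N, C.rate (Sum.inl y) (Sum.inl x) * π (Sum.inl y)) := by
  rw [add_comm (∑ m : Fin (M + 1), _) _]
  simp only [mul_comm (C.rate _ _)]
  refine hasSum_state (g := fun y => π y * C.rate y (Sum.inl x)) fun m =>
    hasSum_single 0 fun l hl => ?_
  simp [rate, hl]

/-- Needed because `∑'` is `0` by default: a zero inflow forces every term to vanish only for a
summable family. -/
theorem summable_in (C : ClassM N M j₀) (π : State N M j₀ → ℝ) (y : State N M j₀) :
    Summable fun x => π x * C.rate x y := by
  rcases y with x | ⟨m, j, hj⟩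
  · exact (C.hasSum_in_inl π x).summable
  · obtain ⟨n, rfl⟩ := Nat.exists_eq_add_of_le hj
    cases n with
    | zero => exact (C.hasSum_in_zero π m).summable
    | succ n => exact (C.hasSum_in_succ π m n).summable

/-! ### Positivity of `π` and stability of the last phase -/

variable {C : ClassM N M j₀} {π : State N M j₀ → ℝ}

/-- A state of probability zero has zero inflow, so its predecessors also have probability zero. By
irreducibility this spreads to all states, against total mass one. -/
theorem IsStationary.pos (hπ : C.IsStationary π) (hC : C.IsIrreducible) (y : State N M j₀) :
    0 < π y := by
  refine (hπ.nonneg y).lt_of_ne' fun hy => ?_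
  have hzero : ∀ x, π x = 0 := by
    intro x
    induction hC x y using Relation.ReflTransGen.head_induction_on with
    | refl => exact hy
    | @head a b hab _ ih =>
      have hb := hπ.balance b
      rw [ih, zero_mul] at hb
      have h0 := (hasSum_zero_iff_of_nonneg
        (fun x => mul_nonneg (hπ.nonneg x) (C.rate_nonneg x b))).1
        (hb ▸ (C.summable_in π b).hasSum)
      have := congrFun h0 a
      simpa [hab.ne'] using this
  have h1 := hπ.hasSum_one
  rw [funext hzero] at h1
  exact zero_ne_one (hasSum_zero.unique h1)

theorem IsStationary.balance_succ (hπ : C.IsStationary π) (m : Fin (M + 1)) (n : ℕ) :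
    (C.lam m + C.mu m + C.alphaTot m) *
        π (State.rep m (j₀ + (n + 1)) (Nat.le_add_right _ _)) =
      C.lam m * π (State.rep m (j₀ + n) (Nat.le_add_right _ _))
        + C.mu m * π (State.rep m (j₀ + (n + 2)) (Nat.le_add_right _ _))
        + ∑ i ∈ Iio m, (C.alp i (m - i) 1 * π (State.rep i (j₀ + n) (Nat.le_add_right _ _))
          + C.alp i (m - i) 0 * π (State.rep i (j₀ + (n + 1)) (Nat.le_add_right _ _))
          + C.alp i (m - i) (-1) * π (State.rep i (j₀ + (n + 2)) (Nat.le_add_right _ _))) := by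
  rw [mul_comm, ← (C.hasSum_out_succ m n).tsum_eq, hπ.balance, (C.hasSum_in_succ π m n).tsum_eq]

/-- The base of the last phase of an ergodic chain is less than one. -/
theorem IsStationary.base_last_lt_one (hπ : C.IsStationary π) (hC : C.IsIrreducible)
    (hl : 0 < C.lam M) (hmu : 0 < C.mu M) : C.base M < 1 := by
  by_contra! hbase
  have hle : C.mu M ≤ C.lam M := by
    have h1 := C.mu_mul_base M hmu
    have h2 := C.phi_le_one M hl
    nlinarith
  set p : ℕ → ℝ := fun n => π (State.rep (Fin.last M) (j₀ + n) (Nat.le_add_right _ _)) with hp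
  have hlim : Tendsto p atTop (𝓝 0) := hπ.tendsto_zero (Fin.last M)
  have hp0 : ∀ n, 0 ≤ p n := fun n => hπ.nonneg _
  have halpha : C.alphaTot M = 0 := by simp [alphaTot]
  -- The net downward flow across consecutive levels decreases by the nonnegative inflow from lower
  -- phases. As its limit is `0`, it is nonnegative throughout; with `μ_M ≤ λ_M` this makes `p`
  -- nondecreasing.
  have hanti : Antitone fun n => C.mu M * p (n + 1) - C.lam M * p n := by
    refine antitone_nat_of_succ_le fun n => ?_
    have h := hπ.balance_succ (Fin.last M) n
    have hs : 0 ≤ ∑ i ∈ Iio (Fin.last M), (C.alp i ((Fin.last M : ℕ) - i) 1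
          * π (State.rep i (j₀ + n) (Nat.le_add_right _ _))
        + C.alp i ((Fin.last M : ℕ) - i) 0
          * π (State.rep i (j₀ + (n + 1)) (Nat.le_add_right _ _))
        + C.alp i ((Fin.last M : ℕ) - i) (-1)
          * π (State.rep i (j₀ + (n + 2)) (Nat.le_add_right _ _))) := by
      refine sum_nonneg fun i hi => ?_
      have hlt : i < Fin.last M := mem_Iio.1 hi
      have hi' : (i : ℕ) < M := hlt
      have ha := C.alp_nonneg i M hi' le_rfl
      have h1 := mul_nonneg (ha 1 (by simp))
        (hπ.nonneg (State.rep i (j₀ + n) (Nat.le_add_right _ _)))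
      have h2 := mul_nonneg (ha 0 (by simp))
        (hπ.nonneg (State.rep i (j₀ + (n + 1)) (Nat.le_add_right _ _)))
      have h3 := mul_nonneg (ha (-1) (by simp))
        (hπ.nonneg (State.rep i (j₀ + (n + 2)) (Nat.le_add_right _ _)))
      exact add_nonneg (add_nonneg h1 h2) h3
    simp only [Fin.val_last, halpha] at h hs
    simp only [hp]
    linarith
  have hglim : Tendsto (fun n => C.mu M * p (n + 1) - C.lam M * p n) atTop (𝓝 0) := by
    simpa using (((tendsto_add_atTop_iff_nat 1).2 hlim).const_mul (C.mu M)).sub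
      (hlim.const_mul (C.lam M))
  have hmono : Monotone p := by
    refine monotone_nat_of_le_succ fun n => ?_
    have h1 := hanti.le_of_tendsto hglim n
    have h2 := mul_le_mul_of_nonneg_right hle (hp0 n)
    have h3 : C.mu M * p n ≤ C.mu M * p (n + 1) := by linarith
    exact le_of_mul_le_mul_left h3 hmu
  have h1 : p 0 ≤ 0 := hmono.ge_of_tendsto hlim 0
  exact h1.not_gt (hπ.pos hC _)

end ClassM

/-! ### Normalization and the main theorem -/

theorem sum_range_eq_multichooseSum {M m : ℕ} (hm : m ≤ M) {a : ℕ → ℝ}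
    (ha : ∀ k, m < k → a k = 0) (n : ℕ) :
    ∑ k ∈ range (m + 1), a k * ((n + k - 1).choose k : ℝ) = multichooseSum (M + 1) a n := by
  refine sum_subset (range_subset_range.2 (by omega)) fun k _ hk => ?_
  rw [ha k (by simpa using hk), zero_mul]

theorem hasSum_sum_multichoose {r : ℝ} (h0 : 0 ≤ r) (h1 : r < 1) (a : ℕ → ℝ) (m : ℕ) :
    HasSum (fun n : ℕ => ∑ k ∈ range (m + 1), a k * ((n + k - 1).choose k : ℝ) * r ^ n)
      (a 0 / (1 - r) + ∑ k ∈ Icc 1 m, a k * r / (1 - r) ^ (k + 1)) := by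
  have h2 : ∑ k ∈ Icc 1 m, a k * r / (1 - r) ^ (k + 1)
      = ∑ k ∈ range m, a (k + 1) * (r / (1 - r) ^ (k + 2)) := by
    rw [range_eq_Ico, sum_Ico_add' (fun k => a k * (r / (1 - r) ^ (k + 1))) 0 m 1]
    exact sum_congr rfl fun k _ => by ring
  rw [h2]
  simp only [sum_range_succ', mul_assoc]
  rw [add_comm]
  refine HasSum.add (hasSum_sum fun k _ => (hasSum_multichoose h0 h1 k).mul_left _) ?_
  simpa [div_eq_mul_inv] using (hasSum_multichoose_zero h0 h1).mul_left (a 0)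

end

/-- In the first conjunct the natural-number binomial `(j - j₀ + k - 1).choose k` is
`C(j - (j₀ + 1) + k, k)` also at `j = j₀`, where it is `1` for `k = 0` and `0` for `k ≥ 1`. -/
theorem theorem4 {N : Type*} [Fintype N] {M j₀ : ℕ} (C : ClassM N M j₀)
    (hErg : C.IsErgodic)
    (hpos : ∀ m ≤ M, 0 < C.lam m ∧ 0 < C.mu m)
    (hbase : ∀ m ≤ M, C.base m = C.base 0)
    (π : State N M j₀ → ℝ) (hπ : C.IsStationary π) :
    ∃ c : ℕ → ℕ → ℝ,
      -- the form of the stationary probabilities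
      (∀ (m : Fin (M + 1)) (j : ℕ) (hj : j₀ ≤ j),
        π (State.rep m j hj) =
          ∑ k ∈ Finset.range (m + 1),
            c m k * ((j - j₀ + k - 1).choose k : ℝ) * C.base 0 ^ (j - j₀)) ∧
      -- the coefficients with `k = 0`
      (∀ m : Fin (M + 1), c m 0 = π (State.rep m j₀ le_rfl)) ∧
      -- the coefficients with `1 ≤ k ≤ m - 1`
      (∀ m k : ℕ, m ≤ M → 1 ≤ k → k < m →
        c m k =
          C.Omega m * C.base 0 *
              (∑ u ∈ Finset.Ico k m, ∑ i ∈ Finset.Ico u m,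
                c i u * ∑ Δ ∈ Finset.Icc (-1 : ℤ) 1,
                  C.alp i (m - i) Δ * C.phi m (C.alphaTot m) ^ (Δ + 1) /
                    (1 - C.base 0 * C.phi m (C.alphaTot m)) ^ (u + 1 - k))
            - 1 / C.lam m * (∑ i ∈ Finset.Ico k m, c i k * C.alp i (m - i) 1)
            + C.Omega m *
              (∑ i ∈ Finset.Ico (k - 1) m,
                c i (k - 1) * ∑ Δ ∈ Finset.Icc (-1 : ℤ) 1,
                  C.alp i (m - i) Δ * C.base 0 ^ (-Δ))) ∧
      -- the coefficients with `k = m ≥ 1`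
      (∀ m : ℕ, 1 ≤ m → m ≤ M →
        c m m = c (m - 1) (m - 1) * C.Omega m *
          ∑ Δ ∈ Finset.Icc (-1 : ℤ) 1, C.alp (m - 1) 1 Δ * C.base 0 ^ (-Δ)) ∧
      -- the balance equation of the state `(m, j₀)`
      (∀ m : Fin (M + 1),
        π (State.rep m j₀ le_rfl) *
            (C.lam m
              + (∑ i ∈ Finset.Ioi m, (C.alp m (i - m) 0 + C.alp m (i - m) 1))
              + ∑ x : N, C.rate (State.rep m j₀ le_rfl) (Sum.inl x)) =
          C.mu m * (∑ k ∈ Finset.range (m + 1), c m k * C.base 0)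
            + (∑ x : N, C.rate (Sum.inl x) (State.rep m j₀ le_rfl) * π (Sum.inl x))
            + ∑ i ∈ Finset.Iio m,
                (C.alp i (m - i) (-1) * (∑ k ∈ Finset.range (i + 1), c i k * C.base 0)
                  + C.alp i (m - i) 0 * π (State.rep i j₀ le_rfl))) ∧
      -- the balance equation of a state of the non-repeating portion
      (∀ x : N,
        π (Sum.inl x) *
            ((∑ m : Fin (M + 1), C.rate (Sum.inl x) (State.rep m j₀ le_rfl))
              + ∑ y : N, C.rate (Sum.inl x) (Sum.inl y)) =
          (∑ m : Fin (M + 1),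
              C.rate (State.rep m j₀ le_rfl) (Sum.inl x) * π (State.rep m j₀ le_rfl))
            + ∑ y : N, C.rate (Sum.inl y) (Sum.inl x) * π (Sum.inl y)) ∧
      -- normalization
      (∑ x : N, π (Sum.inl x))
        + ∑ m : Fin (M + 1),
            (c m 0 / (1 - C.base 0)
              + ∑ k ∈ Finset.Icc 1 (m : ℕ), c m k * C.base 0 / (1 - C.base 0) ^ (k + 1)) = 1 := by
  obtain ⟨hirr, -⟩ := hErg
  have h0 := hpos 0 (Nat.zero_le _)
  have hr := C.base_pos 0 h0.1 h0.2
  have hr1 : C.base 0 < 1 := by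
    rw [← hbase M le_rfl]
    exact hπ.base_last_lt_one hirr (hpos M le_rfl).1 (hpos M le_rfl).2
  -- Phases beyond `M` receive the dummy value `0`, so that phases can be indexed by natural
  -- numbers.
  let p : ℕ → ℕ → ℝ := fun m n =>
    if h : m < M + 1 then π (State.rep ⟨m, h⟩ (j₀ + n) (Nat.le_add_right _ _)) else 0
  have hp : ∀ (m : Fin (M + 1)) (n : ℕ),
      p m n = π (State.rep m (j₀ + n) (Nat.le_add_right _ _)) := fun m n => dif_pos m.2
  have hform := C.eq_multichooseSum_of_balance hpos hbase hr1 p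
    (fun m hm => by
      have := hπ.tendsto_zero ⟨m, Nat.lt_succ_iff.2 hm⟩
      simpa only [← hp] using this)
    (fun m hm n => by
      have := hπ.balance_succ ⟨m, Nat.lt_succ_iff.2 hm⟩ n
      simp only [← hp] at this
      rw [this, sum_Iio_fin ⟨m, Nat.lt_succ_iff.2 hm⟩ (fun i => C.alp i (m - i) 1 * p i n
        + C.alp i (m - i) 0 * p i (n + 1) + C.alp i (m - i) (-1) * p i (n + 2))])
  let c : ℕ → ℕ → ℝ := C.coeff fun i => p i 0
  have hrep : ∀ (m : Fin (M + 1)) (n : ℕ),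
      π (State.rep m (j₀ + n) (Nat.le_add_right _ _)) =
        ∑ k ∈ Finset.range (m + 1), c m k * ((n + k - 1).choose k : ℝ) * C.base 0 ^ n := by
    intro m n
    rw [← hp, hform m (Nat.lt_succ_iff.1 m.2) n, ← Finset.sum_mul,
      sum_range_eq_multichooseSum (Nat.lt_succ_iff.1 m.2) (C.coeff_eq_zero _ m)]
  -- At level `j₀ + 1` every binomial is `C(k, k) = 1`.
  have hone : ∀ m : Fin (M + 1), π (State.rep m (j₀ + 1) (Nat.le_add_right _ _)) =
      ∑ k ∈ Finset.range (m + 1), c m k * C.base 0 := by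
    intro m
    rw [hrep m 1]
    refine Finset.sum_congr rfl fun k _ => ?_
    simp
  refine ⟨c, ?_, ?_, ?_, ?_, ?_, ?_, ?_⟩
  · intro m j hj
    obtain ⟨n, rfl⟩ := Nat.exists_eq_add_of_le hj
    rw [hrep, Nat.add_sub_cancel_left]
  · intro m
    exact (C.coeff_zero _ m).trans (hp m 0)
  · intro m k _ hk _
    exact C.coeff_of_ne_zero _ m (by omega)
  · intro m hm _
    exact C.coeff_self _ hm
  · intro m
    rw [← (C.hasSum_out_zero m).tsum_eq, hπ.balance, (C.hasSum_in_zero π m).tsum_eq]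
    simp only [hone]
  · intro x
    rw [← (C.hasSum_out_inl x).tsum_eq, hπ.balance, (C.hasSum_in_inl π x).tsum_eq]
  -- Normalization: the total mass summed phase by phase must agree with the sum `1`.
  · refine (hasSum_state fun m => ?_).unique hπ.hasSum_one
    simpa only [hrep] using hasSum_sum_multichoose hr.le hr1 (c m) m
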